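/- Let $M$ be a compact, connected topological $3$-manifold, possibly with boundary $\partial M$, and let $p$ be a point of its interior $\operatorname{Int}(M)$. Write $M_p=M\setminus\{p\}$. For a space $X$ let $\operatorname{Mod}(X)=\operatorname{Homeo}(X)/\operatorname{Homeo}_0(X)$, where $\operatorname{Homeo}_0(X)$ is the normal subgroup of the homeomorphisms of $X$ that are isotopic to the identity on $X$. For a loop $\rho\colon[0,1]\to\operatorname{Int}(M)$ based at $p$, let $\phi_\rho$ be the homeomorphism $x\mapsto H(x,1)$ of $(M,\partial M)$, where $H\colon M\times[0,1]\to M$ is an isotopy with $H(x,0)=x$ for all $x\in M$ and $H(p,t)=\rho(t)$ for all $t\in[0,1]$. Then $\phi_\rho(p)=p$, so $\phi_\rho$ restricts to a homeomorphism of $M_p$. Let $\Phi_M\colon\pi_1(M,p)\to\operatorname{Mod}(M_p)$ be the point-pushing map, $\Phi_M(g)=[\phi_\rho]$, where $\rho$ is any loop in $\operatorname{Int}(M)$ based at $p$ with $[\rho]=g$ (such $\rho$ and $H$ exist, and the class $[\phi_\rho]\in\operatorname{Mod}(M_p)$ depends only on $g$). Then the kernel of $\Phi_M$ is contained in the centre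 $Z(\pi_1(M,p))$ of $\pi_1(M,p)$. -/

import Mathlib

open scoped unitInterval

/-- The interior of a topological `3`-manifold `M` (possibly with boundary): the points that lie in
the domain of a homeomorphism from an open subset of `M` onto an open subset of `ℝ³`. (No preferred
atlas is involved.) The boundary `∂M` is the complement. -/
def interior3 (M : Type*) [TopologicalSpace M] : Set M :=
  {x | ∃ e : OpenPartialHomeomorph M (EuclideanSpace ℝ (Fin 3)), x ∈ e.source}

/-- Every homeomorphism `M → M` is automatically a homeomorphism of pairs `(M, ∂M) → (M, ∂M)`. -/
theorem Homeomorph.apply_mem_interior3_iff {M : Type*} [TopologicalSpace M] (f : M ≃ₜ M) (x : M) :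
    f x ∈ interior3 M ↔ x ∈ interior3 M := by
  constructor
  · rintro ⟨e, he⟩
    exact ⟨f.toOpenPartialHomeomorph.trans e, by simpa using he⟩
  · rintro ⟨e, he⟩
    exact ⟨f.symm.toOpenPartialHomeomorph.trans e, by simpa using he⟩

/-- An isotopy of `X` from the homeomorphism `f` to the homeomorphism `g`: a jointly continuous map
`X × [0,1] → X`, every time-`t` level of which is a homeomorphism of `X`. -/
structure HomeoIsotopy {X : Type*} [TopologicalSpace X] (f g : X ≃ₜ X) where
  /-- the homeomorphism at time `t` -/
  level : I → (X ≃ₜ X)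
  continuous_uncurry : Continuous fun q : X × I => level q.2 q.1
  level_zero : level 0 = f
  level_one : level 1 = g

/-- `Homeo₀(X)`: the group of homeomorphisms of `X` that are isotopic to the identity on `X`. -/
def homeoZero (X : Type*) [TopologicalSpace X] : Subgroup (X ≃ₜ X) where
  carrier := {f | Nonempty (HomeoIsotopy 1 f)}
  one_mem' := ⟨⟨fun _ => 1, continuous_fst, rfl, rfl⟩⟩
  mul_mem' := by
    rintro f g ⟨F⟩ ⟨G⟩
    exact ⟨⟨fun t => F.level t * G.level t,
      F.continuous_uncurry.comp (G.continuous_uncurry.prodMk continuous_snd),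
      by simp [F.level_zero, G.level_zero], by simp [F.level_one, G.level_one]⟩⟩
  inv_mem' := by
    rintro f ⟨F⟩
    exact ⟨⟨fun t => f⁻¹ * F.level (σ t),
      f.symm.continuous.comp (F.continuous_uncurry.comp
        (continuous_fst.prodMk (unitInterval.continuous_symm.comp continuous_snd))),
      by simp [F.level_one], by simp [F.level_zero]⟩⟩

instance homeoZero_normal (X : Type*) [TopologicalSpace X] : (homeoZero X).Normal where
  conj_mem := by
    rintro f ⟨F⟩ g
    exact ⟨⟨fun t => g * F.level t * g⁻¹,
      g.continuous.comp (F.continuous_uncurry.comp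
        ((g.symm.continuous.comp continuous_fst).prodMk continuous_snd)),
      by simp [F.level_zero], by simp [F.level_one]⟩⟩

/-- The mapping class group `Mod(X) = Homeo(X) / Homeo₀(X)`. -/
abbrev MappingClassGroup (X : Type*) [TopologicalSpace X] : Type _ :=
  (X ≃ₜ X) ⧸ homeoZero X

/-- The punctured space `M_p = M ∖ {p}`. -/
abbrev Punctured (M : Type*) (p : M) : Type _ := {x : M // x ≠ p}

/-- A homeomorphism of `M` that fixes `p`, viewed as a homeomorphism of `M_p`. -/
def Homeomorph.puncture {M : Type*} [TopologicalSpace M] {p : M} (φ : M ≃ₜ M) (hφ : φ p = p) :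
    Punctured M p ≃ₜ Punctured M p :=
  φ.subtype fun x => not_congr (by
    constructor
    · rintro rfl; exact hφ
    · intro h; exact φ.injective (h.trans hφ.symm))

/-- `φ` is a homeomorphism `φ_ρ`: the end of an (ambient) isotopy of `M` that starts at the identity
and takes the point `p` once along the loop `ρ`. -/
def IsPushAlong {M : Type*} [TopologicalSpace M] {p : M} (ρ : Path p p) (φ : M ≃ₜ M) : Prop :=
  ∃ H : HomeoIsotopy 1 φ, ∀ t : I, H.level t p = ρ t

/-- `c` is the class in `Mod(M_p)` of a homeomorphism `φ_ρ`, for some loop `ρ` in the interior of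
`M` based at `p` that represents `g ∈ π₁(M,p)`. -/
def IsPushClass {M : Type*} [TopologicalSpace M] {p : M} (g : FundamentalGroup M p)
    (c : MappingClassGroup (Punctured M p)) : Prop :=
  ∃ (ρ : Path p p) (φ : M ≃ₜ M) (hφ : φ p = p),
    (∀ t, ρ t ∈ interior3 M) ∧
    FundamentalGroup.fromPath (Path.Homotopic.Quotient.mk ρ) = g ∧
    IsPushAlong ρ φ ∧
    c = QuotientGroup.mk (φ.puncture hφ)

open Classical in
/-- The point-pushing map `Φ_M : π₁(M,p) → Mod(M_p)`, sending `g` to `[φ_ρ]` for any loop `ρ` in the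
interior of `M` based at `p` with `[ρ] = g`. For a compact connected `3`-manifold `M` and an
interior point `p`, such `ρ` and `φ_ρ` exist for every `g`, and `[φ_ρ]` depends only on `g`. -/
noncomputable def pointPushingMap (M : Type*) [TopologicalSpace M] (p : M)
    (g : FundamentalGroup M p) : MappingClassGroup (Punctured M p) :=
  if h : ∃ c, IsPushClass g c then h.choose else 1

/-!
Suppose that the class `[φ_ρ]` is trivial in `Mod(M_p)`. The map `φ_ρ` is then the end of two
isotopies of `M` that start at the identity. The first, from the definition of `φ_ρ`, drags `p` along
`ρ`, so that `φ_ρ` acts on `π₁(M, p)` as conjugation by `[ρ]`. The second is the isotopy of `M_p`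
extended by fixing `p`, so that `φ_ρ` acts trivially. Hence `[ρ]` commutes with every element
(`mem_center_of_puncture_mem_homeoZero`). What has to be checked is that the extended isotopy is
jointly continuous at `p`. The definition of an isotopy asks only for joint continuity and for
homeomorphisms at each time, so this amounts to a uniform properness in time, which holds because
`M` is locally connected (`continuous_extendByPuncture_isotopy`).

The definition of the point-pushing map gives it the value `1` at a class `g` with no push map, so
the existence of push maps is part of the claim (`exists_isPushClass`). It suffices that each path
class between interior points contains the track of some ambient isotopy, since a track of an
interior point stays in the interior. Tracks can be concatenated and reversed, so the question is
local. In a chart with values in `ℝ³` a point is pushed inside a ball by an explicit homeomorphism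
(`exists_homeomorph_add_tent`); consequently half-balls in charts are sets in which all interior
points can be pushed to each other and all paths with common endpoints are homotopic
(`exists_isPushSet`). A connectedness argument along the path then gives the global statement
(`isTrackClass_of_mem_interior3`).
-/

open Topology Set Filter

/-! ### Extending isotopies over the puncture -/

/-- Extends the levels of an isotopy of `M_p` to `M` by fixing the puncture. -/
noncomputable def extendByPuncture {M : Type*} {p : M} (f : Punctured M p → Punctured M p) (x : M) :
    M :=
  open Classical in if h : x = p then p else f ⟨x, h⟩

section
variable {M : Type*} {p : M}

@[simp]
theorem extendByPuncture_self (f : Punctured M p → Punctured M p) : extendByPuncture f p = p := by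
  simp [extendByPuncture]

theorem extendByPuncture_of_ne (f : Punctured M p → Punctured M p) {x : M} (h : x ≠ p) :
    extendByPuncture f x = f ⟨x, h⟩ := by
  simp [extendByPuncture, h]

variable [TopologicalSpace M]

/-- Away from the puncture the extension is as continuous as the original family. -/
theorem continuousAt_extendByPuncture_of_ne [T1Space M] {T : Type*} [TopologicalSpace T]
    {G : T → Punctured M p → Punctured M p}
    (hG : Continuous fun q : Punctured M p × T => G q.2 q.1) {x : M} (hx : x ≠ p) (t : T) :
    ContinuousAt (fun q : M × T => extendByPuncture (G q.2) q.1) (x, t) := by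
  have hemb : IsOpenEmbedding (Prod.map Subtype.val id : Punctured M p × T → M × T) :=
    (isOpen_compl_singleton (x := p)).isOpenEmbedding_subtypeVal.prodMap .id
  have := hemb.continuousAt_iff (g := fun q : M × T => extendByPuncture (G q.2) q.1)
    (x := (⟨x, hx⟩, t))
  refine this.1 (Continuous.continuousAt ?_)
  refine (continuous_subtype_val.comp hG).congr fun q => ?_
  simp [extendByPuncture_of_ne _ q.1.2]

/-- The extension of a homeomorphism of `M_p` is continuous at the puncture, because a
homeomorphism is proper. -/
theorem continuous_extendByPuncture [T2Space M] [CompactSpace M]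
    (f : Punctured M p ≃ₜ Punctured M p) : Continuous (extendByPuncture f) := by
  rw [continuous_iff_continuousAt]
  intro x
  rcases eq_or_ne x p with rfl | hx
  · rw [ContinuousAt, extendByPuncture_self]
    intro U hU
    obtain ⟨V, hVU, hVo, hV⟩ := mem_nhds_iff.1 hU
    have hK : IsCompact (Subtype.val ⁻¹' Vᶜ : Set (Punctured M x)) := by
      refine Topology.IsInducing.subtypeVal.isCompact_preimage_iff ?_ |>.2
        hVo.isClosed_compl.isCompact
      intro y hy
      exact ⟨⟨y, fun h => hy (h ▸ hV)⟩, rfl⟩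
    have hK' := ((hK.image f.symm.continuous).image continuous_subtype_val).isClosed
    rw [Filter.mem_map]
    refine mem_of_superset (hK'.isOpen_compl.mem_nhds ?_) ?_
    · rintro ⟨y, -, hy⟩
      exact y.2 hy
    · intro y hy
      refine hVU ?_
      by_contra hyV
      rcases eq_or_ne y x with rfl | hyx
      · exact hyV (by simpa using hV)
      · rw [extendByPuncture_of_ne _ hyx] at hyV
        exact hy ⟨⟨y, hyx⟩, ⟨f ⟨y, hyx⟩, hyV, by simp⟩, rfl⟩
  · have := continuousAt_extendByPuncture_of_ne (T := Unit) (G := fun _ => f)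
      (f.continuous.comp continuous_fst) hx ()
    exact this.comp (f := fun y : M => (y, ())) (by fun_prop)

/-- The joint continuity at the puncture of the extension of an isotopy of `M_p`. The argument is
that of Arens for the continuity of inversion in the homeomorphism group of a locally connected
space: for a small neighbourhood `V` of `p`, the boundary of `V` is compact, so for nearby times its
image stays off a given small connected set `W` outside the image of `V`; since `W` still contains
an image of a point outside `V`, it is disjoint from the image of `V`. -/
theorem continuous_extendByPuncture_isotopy [T2Space M] [CompactSpace M] [LocallyConnectedSpace M]
    {T : Type*} [TopologicalSpace T] {G : T → (Punctured M p ≃ₜ Punctured M p)}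
    (hG : Continuous fun q : Punctured M p × T => G q.2 q.1) :
    Continuous fun q : M × T => extendByPuncture (G q.2) q.1 := by
  rw [continuous_iff_continuousAt]
  rintro ⟨x, t₀⟩
  rcases eq_or_ne x p with rfl | hx
  swap
  · exact continuousAt_extendByPuncture_of_ne (G := fun t => G t) hG hx t₀
  have hF (t : T) := continuous_extendByPuncture (G t)
  rw [ContinuousAt, extendByPuncture_self]
  intro U' hU'
  obtain ⟨U, hUU', hUo, hU⟩ := mem_nhds_iff.1 hU'
  obtain ⟨C, hCx, hCc, hCU⟩ := exists_mem_nhds_isClosed_subset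
    ((hF t₀).continuousAt.preimage_mem_nhds (t := U) (x := x)
      (by simpa using hUo.mem_nhds hU))
  obtain ⟨V, hVC, hVo, hxV⟩ := mem_nhds_iff.1 hCx
  have hVC' : closure V ⊆ C := closure_minimal hVC hCc
  have hfr : x ∉ frontier V := fun h => (hVo.frontier_eq ▸ h).2 hxV
  have key : ∀ᶠ t in 𝓝 t₀, ∀ k ∈ Uᶜ, ∀ y ∈ V, extendByPuncture (G t) y ≠ k := by
    refine hUo.isClosed_compl.isCompact.eventually_forall_of_forall_eventually fun k hk => ?_
    have hcpt : IsCompact (extendByPuncture (G t₀) '' frontier V) :=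
      isClosed_frontier.isCompact.image (hF t₀)
    have hkfr : k ∉ extendByPuncture (G t₀) '' frontier V := by
      rintro ⟨y, hy, rfl⟩
      exact hk (hCU (hVC' (frontier_subset_closure hy)))
    obtain ⟨A, B, hA, hB, hkA, hfB, hAB⟩ :=
      SeparatedNhds.of_isCompact_isCompact isCompact_singleton hcpt (by simpa using hkfr)
    obtain ⟨W, ⟨hWo, hkW, hWc⟩, hWA⟩ :=
      (LocallyConnectedSpace.open_connected_basis k).mem_iff.1 (hA.mem_nhds (hkA rfl))
    have hkx : k ≠ x := fun h => hk (h ▸ hU)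
    -- the point that `G t₀` takes to `k`
    obtain ⟨y, hyx, hyk⟩ : ∃ y, y ≠ x ∧ extendByPuncture (G t₀) y = k := by
      refine ⟨(G t₀).symm ⟨k, hkx⟩, ((G t₀).symm ⟨k, hkx⟩).2, ?_⟩
      rw [extendByPuncture_of_ne _ ((G t₀).symm ⟨k, hkx⟩).2]
      simp
    have hyV : y ∉ closure V := fun h => hk (hyk ▸ hCU (hVC' h))
    have h1 : ∀ᶠ t in 𝓝 t₀, extendByPuncture (G t) y ∈ W := by
      have := (continuousAt_extendByPuncture_of_ne (G := fun t => G t) hG hyx t₀).comp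
        (f := fun t : T => (y, t)) (by fun_prop)
      exact this.preimage_mem_nhds (hWo.mem_nhds (by simpa [hyk] using hkW))
    have h2 : ∀ᶠ t in 𝓝 t₀, ∀ z ∈ frontier V, extendByPuncture (G t) z ∈ B := by
      refine isClosed_frontier.isCompact.eventually_forall_of_forall_eventually fun z hz => ?_
      have hzx : z ≠ x := fun h => hfr (h ▸ hz)
      have := (continuousAt_extendByPuncture_of_ne (G := fun t => G t) hG hzx t₀).comp
        (f := Prod.swap) (x := (t₀, z)) (by fun_prop)
      exact this.preimage_mem_nhds (hB.mem_nhds (hfB ⟨z, hz, rfl⟩))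
    have h3 : ∀ᶠ t in 𝓝 t₀, ∀ v ∈ V, extendByPuncture (G t) v ∉ W := by
      filter_upwards [h1, h2] with t ht1 ht2 v hv hvW
      let e : M ≃ M :=
        { toFun := extendByPuncture (G t)
          invFun := extendByPuncture (G t).symm
          left_inv := fun z => by
            rcases eq_or_ne z x with rfl | hz
            · simp
            · rw [extendByPuncture_of_ne (G t) hz,
                extendByPuncture_of_ne _ (G t ⟨z, hz⟩).2]
              simp
          right_inv := fun z => by
            rcases eq_or_ne z x with rfl | hz
            · simp
            · rw [extendByPuncture_of_ne _ hz,
                extendByPuncture_of_ne _ ((G t).symm ⟨z, hz⟩).2]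
              simp }
      have hpre : IsPreconnected (extendByPuncture (G t) ⁻¹' W) := by
        have : extendByPuncture (G t) ⁻¹' W = extendByPuncture (G t).symm '' W :=
          (e.symm.image_eq_preimage_symm W).symm
        rw [this]
        exact hWc.isPreconnected.image _ (continuous_extendByPuncture (G t).symm).continuousOn
      obtain ⟨z, hzW, hz⟩ := hpre V (closure V)ᶜ hVo isClosed_closure.isOpen_compl
        (fun z hzW => by
          by_cases hz : z ∈ closure V
          · refine Or.inl (by_contra fun hzV => ?_)
            exact hAB.le_bot ⟨hWA hzW, ht2 z (hVo.frontier_eq ▸ ⟨hz, hzV⟩)⟩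
          · exact Or.inr hz) ⟨v, hvW, hv⟩ ⟨y, ht1, hyV⟩
      exact hz.2 (subset_closure hz.1)
    rw [nhds_prod_eq]
    filter_upwards [h3.prod_mk (hWo.eventually_mem hkW)] with q hq v hv hvk
    exact hq.1 v hv (hvk ▸ hq.2)
  rw [nhds_prod_eq, Filter.mem_map]
  filter_upwards [(hVo.eventually_mem hxV).prod_mk key] with q hq
  exact hUU' (by_contra fun h => hq.2 _ h q.1 hq.1 rfl)

end

/-! ### The action of push maps on the fundamental group -/

/-- The two ways around the boundary of a map of the square are homotopic, since they are in the
square itself. -/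
theorem Path.Homotopic.trans_of_square {X : Type*} [TopologicalSpace X] {a b c d : X}
    {γ : Path a b} {γ' : Path c d} {ρ : Path a c} {ρ' : Path b d} (F : C(I × I, X))
    (hγ : ∀ s, F (s, 0) = γ s) (hγ' : ∀ s, F (s, 1) = γ' s)
    (hρ : ∀ t, F (0, t) = ρ t) (hρ' : ∀ t, F (1, t) = ρ' t) :
    (γ.trans ρ').Homotopic (ρ.trans γ') := by
  obtain rfl : a = F (0, 0) := by simp [hγ]
  obtain rfl : b = F (1, 0) := by simp [hγ]
  obtain rfl : c = F (0, 1) := by simp [hγ']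
  obtain rfl : d = F (1, 1) := by simp [hγ']
  let B (u : I) : Path ((0 : I), u) ((1 : I), u) := ⟨⟨fun s => (s, u), by fun_prop⟩, rfl, rfl⟩
  let L (u : I) : Path (u, (0 : I)) (u, (1 : I)) := ⟨⟨fun s => (u, s), by fun_prop⟩, rfl, rfl⟩
  obtain rfl : γ = (B 0).map F.continuous := by ext s; simp [B, hγ]
  obtain rfl : γ' = (B 1).map F.continuous := by ext s; simp [B, hγ']
  obtain rfl : ρ = (L 0).map F.continuous := by ext s; simp [L, hρ]
  obtain rfl : ρ' = (L 1).map F.continuous := by ext s; simp [L, hρ']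
  have : ContractibleSpace I := (convex_Icc (0 : ℝ) 1).contractibleSpace ⟨0, by simp⟩
  rw [← Path.map_trans, ← Path.map_trans]
  exact (SimplyConnectedSpace.paths_homotopic _ _).map F

/-- If the time-one map `φ` of an isotopy of `M` that drags `p` along the loop `ρ` is isotopic to
the identity on `M_p`, then `[ρ]` is central. The first isotopy shows that `φ` acts on `π₁(M, p)` as
conjugation by `[ρ]`; the second, extended over `p`, shows that `φ` acts trivially. -/
theorem mem_center_of_puncture_mem_homeoZero {M : Type*} [TopologicalSpace M] [T2Space M]
    [CompactSpace M] [LocallyConnectedSpace M] {p : M} {ρ : Path p p} {φ : M ≃ₜ M} (hφ : φ p = p)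
    (hρ : IsPushAlong ρ φ) (h : φ.puncture hφ ∈ homeoZero (Punctured M p)) :
    FundamentalGroup.fromPath (Path.Homotopic.Quotient.mk ρ) ∈
      Subgroup.center (FundamentalGroup M p) := by
  obtain ⟨H, hH⟩ := hρ
  obtain ⟨G⟩ := h
  rw [Subgroup.mem_center_iff]
  intro g
  obtain ⟨γ, rfl⟩ := Path.Homotopic.Quotient.mk_surjective g
  let γ' : Path p p := (γ.map φ.continuous).cast hφ.symm hφ.symm
  have h1 : (γ.trans ρ).Homotopic (ρ.trans γ') := by
    refine Path.Homotopic.trans_of_square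
      ⟨fun q => H.level q.2 (γ q.1), H.continuous_uncurry.comp
        (f := fun q : I × I => (γ q.1, q.2)) (by fun_prop)⟩ ?_ ?_ ?_ ?_ <;>
    intro s <;> simp [H.level_zero, H.level_one, hH, γ']
  have h2 : (γ.trans (Path.refl p)).Homotopic ((Path.refl p).trans γ') := by
    refine Path.Homotopic.trans_of_square
      ⟨fun q => extendByPuncture (G.level q.2) (γ q.1),
        (continuous_extendByPuncture_isotopy G.continuous_uncurry).comp
        (f := fun q : I × I => (γ q.1, q.2)) (by fun_prop)⟩ ?_ ?_ ?_ ?_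
    · intro s
      rcases eq_or_ne (γ s) p with h | h
      · simp [h]
      · simp [extendByPuncture_of_ne _ h, G.level_zero]
    · intro s
      rcases eq_or_ne (γ s) p with h | h
      · simp [h, γ', hφ]
      · simp [extendByPuncture_of_ne _ h, G.level_one, γ', Homeomorph.puncture]
    · simp
    · simp
  have h3 : γ.Homotopic γ' :=
    (Path.Homotopic.trans ⟨(Path.Homotopy.transRefl γ).symm⟩ h2).trans ⟨Path.Homotopy.reflTrans γ'⟩
  exact Path.Homotopic.Quotient.eq.2 ((Path.Homotopic.hcomp (.refl ρ) h3).trans h1.symm)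

/-! ### Tracks of ambient isotopies -/

/-- The path `ρ` from `a` to `b` is traced by the point `a` under an ambient isotopy that starts at
the identity. For a loop this says that some `φ` satisfies `IsPushAlong ρ φ`. -/
def IsTrack {M : Type*} [TopologicalSpace M] {a b : M} (ρ : Path a b) : Prop :=
  ∃ φ : M ≃ₜ M, ∃ H : HomeoIsotopy 1 φ, ∀ t : I, H.level t a = ρ t

/-- The homotopy class `c` of paths from `a` to `b` contains a track of an ambient isotopy. -/
def IsTrackClass {M : Type*} [TopologicalSpace M] {a b : M} (c : Path.Homotopic.Quotient a b) :
    Prop :=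
  ∃ ρ : Path a b, IsTrack ρ ∧ Path.Homotopic.Quotient.mk ρ = c

/-- An ambient isotopy drags `a` to `b` along a path inside `V`. -/
def PushableIn {M : Type*} [TopologicalSpace M] (V : Set M) (a b : M) : Prop :=
  ∃ ρ : Path a b, IsTrack ρ ∧ range ρ ⊆ V

section
variable {M : Type*} [TopologicalSpace M]

theorem IsTrack.trans {a b c : M} {ρ : Path a b} {ρ' : Path b c} (h : IsTrack ρ)
    (h' : IsTrack ρ') : IsTrack (ρ.trans ρ') := by
  obtain ⟨φ, H, hH⟩ := h
  obtain ⟨ψ, H', hH'⟩ := h'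
  have hφ : φ a = b := by rw [← H.level_one, hH, ρ.target]
  -- the first isotopy runs on `[0, 1/2]` and then stays at `φ`, the second one runs on `[1/2, 1]`
  refine ⟨ψ * φ, ⟨fun t => H'.level (projIcc 0 1 zero_le_one (2 * t - 1)) *
      H.level (projIcc 0 1 zero_le_one (2 * t)), ?_, ?_, ?_⟩, fun t => ?_⟩
  · have h1 : Continuous fun q : M × I =>
        H.level (projIcc 0 1 zero_le_one (2 * (q.2 : ℝ))) q.1 :=
      H.continuous_uncurry.comp
        (continuous_fst.prodMk ((continuous_projIcc (h := zero_le_one)).comp (by fun_prop)))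
    exact H'.continuous_uncurry.comp
      (h1.prodMk ((continuous_projIcc (h := zero_le_one)).comp (by fun_prop)))
  · have h1 : projIcc (0 : ℝ) 1 zero_le_one (2 * (0 : I) - 1) = 0 :=
      projIcc_of_le_left _ (by norm_num)
    have h2 : projIcc (0 : ℝ) 1 zero_le_one (2 * (0 : I)) = 0 :=
      projIcc_of_le_left _ (by norm_num)
    rw [h1, h2, H.level_zero, H'.level_zero, one_mul]
  · have h1 : projIcc (0 : ℝ) 1 zero_le_one (2 * (1 : I) - 1) = 1 :=
      projIcc_of_right_le _ (by norm_num)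
    have h2 : projIcc (0 : ℝ) 1 zero_le_one (2 * (1 : I)) = 1 :=
      projIcc_of_right_le _ (by norm_num)
    rw [h1, h2, H.level_one, H'.level_one]
  · change H'.level _ (H.level _ a) = _
    rw [Path.trans_apply]
    split_ifs with ht
    · have h1 : projIcc (0 : ℝ) 1 zero_le_one (2 * t - 1) = 0 :=
        projIcc_of_le_left _ (by linarith)
      rw [h1, H'.level_zero, projIcc_of_mem _ ((unitInterval.mul_pos_mem_iff zero_lt_two).2
        ⟨t.2.1, ht⟩), hH]
      rfl
    · have ht' := (not_le.1 ht).le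
      have h2 : projIcc (0 : ℝ) 1 zero_le_one (2 * t) = 1 :=
        projIcc_of_right_le _ (by linarith)
      rw [h2, H.level_one, hφ, projIcc_of_mem _ (unitInterval.two_mul_sub_one_mem_iff.2
        ⟨ht', t.2.2⟩), hH']

theorem IsTrack.symm {a b : M} {ρ : Path a b} (h : IsTrack ρ) : IsTrack ρ.symm := by
  obtain ⟨φ, H, hH⟩ := h
  have hφ : φ⁻¹ b = a := by
    change φ.symm b = a
    rw [Homeomorph.symm_apply_eq, ← H.level_one, hH, ρ.target]
  refine ⟨φ⁻¹, ⟨fun t => H.level (σ t) * φ⁻¹, ?_, ?_, ?_⟩, fun t => ?_⟩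
  · exact H.continuous_uncurry.comp (f := fun q : M × I => (φ.symm q.1, σ q.2)) (by fun_prop)
  · simp [H.level_one]
  · simp [H.level_zero]
  · change H.level (σ t) (φ⁻¹ b) = _
    rw [hφ, hH]
    rfl

theorem IsTrackClass.trans {a b c : M} {γ : Path.Homotopic.Quotient a b}
    {γ' : Path.Homotopic.Quotient b c} (h : IsTrackClass γ) (h' : IsTrackClass γ') :
    IsTrackClass (γ.trans γ') := by
  obtain ⟨ρ, hρ, rfl⟩ := h
  obtain ⟨ρ', hρ', rfl⟩ := h'
  exact ⟨ρ.trans ρ', hρ.trans hρ', Path.Homotopic.Quotient.mk_trans _ _⟩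

theorem PushableIn.mono {V W : Set M} {a b : M} (h : PushableIn V a b) (hVW : V ⊆ W) :
    PushableIn W a b :=
  let ⟨ρ, hρ, hV⟩ := h
  ⟨ρ, hρ, hV.trans hVW⟩

theorem PushableIn.symm {V : Set M} {a b : M} (h : PushableIn V a b) : PushableIn V b a :=
  let ⟨ρ, hρ, hV⟩ := h
  ⟨ρ.symm, hρ.symm, ρ.symm_range.trans_subset hV⟩

theorem PushableIn.trans {V : Set M} {a b c : M} (h : PushableIn V a b)
    (h' : PushableIn V b c) : PushableIn V a c :=
  let ⟨ρ, hρ, hV⟩ := h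
  let ⟨ρ', hρ', hV'⟩ := h'
  ⟨ρ.trans ρ', hρ.trans hρ', (ρ.trans_range ρ').trans_subset (union_subset hV hV')⟩

/-! ### Pushing points inside a chart -/

/-- The self-map of `M` that is `g` in the chart `e` and the identity outside its domain. -/
noncomputable def OpenPartialHomeomorph.transplant {E : Type*} [TopologicalSpace E]
    (e : OpenPartialHomeomorph M E) (g : E → E) (x : M) : M :=
  open Classical in if x ∈ e.source then e.symm (g (e x)) else x

variable {E : Type*} [TopologicalSpace E] (e : OpenPartialHomeomorph M E)

theorem OpenPartialHomeomorph.transplant_of_mem (g : E → E) {x : M} (hx : x ∈ e.source) :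
    e.transplant g x = e.symm (g (e x)) := by
  simp [transplant, hx]

theorem OpenPartialHomeomorph.transplant_of_notMem {g : E → E} {K : Set E}
    (hg : ∀ z ∉ K, g z = z) {x : M} (hx : x ∉ e.symm '' K) : e.transplant g x = x := by
  by_cases hxe : x ∈ e.source
  · rw [e.transplant_of_mem g hxe, hg, e.left_inv hxe]
    exact fun h => hx ⟨_, h, e.left_inv hxe⟩
  · simp [transplant, hxe]

theorem OpenPartialHomeomorph.continuous_transplant [T2Space M] {T : Type*} [TopologicalSpace T]
    {g : T → E → E} (hg : Continuous fun q : E × T => g q.2 q.1) {K : Set E} (hK : IsCompact K)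
    (hKe : K ⊆ e.target) (hgK : ∀ t, ∀ z ∉ K, g t z = z)
    (hge : ∀ t, MapsTo (g t) e.target e.target) :
    Continuous fun q : M × T => e.transplant (g q.2) q.1 := by
  rw [continuous_iff_continuousAt]
  rintro ⟨x, t⟩
  by_cases hx : x ∈ e.source
  · have h1 : ContinuousAt (fun q : M × T => g q.2 (e q.1)) (x, t) :=
      hg.continuousAt.comp (f := fun q : M × T => (e q.1, q.2))
        (((e.continuousAt hx).comp continuousAt_fst).prodMk continuousAt_snd)
    have h2 : ContinuousAt (fun q : M × T => e.symm (g q.2 (e q.1))) (x, t) :=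
      (e.continuousAt_symm (hge t (e.map_source hx))).comp
        (f := fun q : M × T => g q.2 (e q.1)) h1
    refine h2.congr ?_
    filter_upwards [continuousAt_fst.preimage_mem_nhds (e.open_source.mem_nhds hx)] with q hq
    exact (e.transplant_of_mem _ hq).symm
  · have hcl : IsClosed (e.symm '' K) :=
      (hK.image_of_continuousOn (e.continuousOn_symm.mono hKe)).isClosed
    have hx' : x ∉ e.symm '' K := by
      rintro ⟨z, hz, rfl⟩
      exact hx (e.map_target (hKe hz))
    refine continuousAt_fst.congr ?_
    filter_upwards [continuousAt_fst.preimage_mem_nhds (hcl.isOpen_compl.mem_nhds hx')] with q hq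
    exact (e.transplant_of_notMem (hgK q.2) hq).symm

theorem OpenPartialHomeomorph.transplant_transplant {g g' : E → E} (h : ∀ z, g' (g z) = z)
    (hg : MapsTo g e.target e.target) (x : M) : e.transplant g' (e.transplant g x) = x := by
  by_cases hx : x ∈ e.source
  · have := hg (e.map_source hx)
    rw [e.transplant_of_mem g hx, e.transplant_of_mem g' (e.map_target this), e.right_inv this, h,
      e.left_inv hx]
  · simp [transplant, hx]

/-- An isotopy of the model space that is supported in a compact part of the chart `e` gives an
isotopy of `M`. -/
theorem OpenPartialHomeomorph.isTrack_of_isotopy [T2Space M] {f : I → (E ≃ₜ E)}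
    (hf : Continuous fun q : E × I => f q.2 q.1) (hf0 : f 0 = 1) {K : Set E} (hK : IsCompact K)
    (hKe : K ⊆ e.target) (hfK : ∀ t, ∀ z ∉ K, f t z = z) {a b : M} (ha : a ∈ e.source)
    {ρ : Path a b} (hρ : ∀ t, e.symm (f t (e a)) = ρ t) : IsTrack ρ := by
  have hfK' (t : I) (z : E) (hz : z ∉ K) : (f t).symm z = z := by
    rw [Homeomorph.symm_apply_eq, hfK t z hz]
  have hfe (t : I) : MapsTo (f t) e.target e.target := by
    intro z hz
    by_contra h
    exact h (by rwa [(f t).injective (hfK t _ fun hK => h (hKe hK))])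
  have hfe' (t : I) : MapsTo (f t).symm e.target e.target := by
    intro z hz
    by_contra h
    exact h (by rwa [(f t).symm.injective (hfK' t _ fun hK => h (hKe hK))])
  have hc := e.continuous_transplant (g := fun t => f t) hf hK hKe hfK hfe
  let F (t : I) : M ≃ₜ M :=
    { toFun := e.transplant (f t)
      invFun := e.transplant (f t).symm
      left_inv := e.transplant_transplant (by simp) (hfe t)
      right_inv := e.transplant_transplant (by simp) (hfe' t)
      continuous_toFun := hc.comp (f := fun x => (x, t)) (by fun_prop)
      continuous_invFun :=
        (e.continuous_transplant (T := Unit) (g := fun _ => (f t).symm)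
          ((f t).symm.continuous.comp continuous_fst) hK hKe (fun _ => hfK' t)
          (fun _ => hfe' t)).comp (f := fun x => (x, ())) (by fun_prop) }
  refine ⟨F 1, ⟨F, hc, ?_, rfl⟩, fun t => (e.transplant_of_mem _ ha).trans (hρ t)⟩
  ext x
  exact e.transplant_of_notMem (K := ∅) (by simp [hf0]) (by simp)

end

/-- A point can be pushed inside a ball of a normed space by less than the radius: the map
`z ↦ z + λ(z) v`, where `λ` decreases linearly from `1` at the centre to `0` on the sphere, is a
homeomorphism, as it differs from the identity by a contraction. -/
theorem exists_homeomorph_add_tent {E : Type*} [NormedAddCommGroup E] [NormedSpace ℝ E]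
    [CompleteSpace E] (x : E) {r : ℝ} (v : E) (hv : ‖v‖ < r) :
    ∃ f : E ≃ₜ E, ∀ z, f z = z + max 0 (1 - dist z x / r) • v := by
  have hr : 0 < r := (norm_nonneg v).trans_lt hv
  set tent : E → ℝ := fun z => max 0 (1 - dist z x / r) with htent
  have hlip (z w : E) : |tent z - tent w| ≤ ‖z - w‖ / r := by
    have h1 : |tent z - tent w| ≤ |(1 - dist z x / r) - (1 - dist w x / r)| := by
      simpa [htent, max_comm] using abs_max_sub_max_le_abs (1 - dist z x / r) (1 - dist w x / r) 0
    have h2 : (1 - dist z x / r) - (1 - dist w x / r) = (dist w x - dist z x) / r := by ring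
    rw [h2, abs_div, abs_of_pos hr] at h1
    refine h1.trans (div_le_div_of_nonneg_right ?_ hr.le)
    rw [← dist_eq_norm, dist_comm z w]
    exact abs_dist_sub_le w z x
  have happ : ApproximatesLinearOn (fun z => z + tent z • v)
      ((ContinuousLinearEquiv.refl ℝ E : E ≃L[ℝ] E) : E →L[ℝ] E) univ
      (‖v‖₊ / r.toNNReal) := by
    intro z _ w _
    have : z + tent z • v - (w + tent w • v) -
        ((ContinuousLinearEquiv.refl ℝ E : E ≃L[ℝ] E) : E →L[ℝ] E) (z - w) =
        (tent z - tent w) • v := by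
      simp only [ContinuousLinearEquiv.coe_coe, ContinuousLinearEquiv.coe_refl', id_eq, sub_smul]
      abel
    rw [this, norm_smul, Real.norm_eq_abs, NNReal.coe_div, coe_nnnorm, Real.coe_toNNReal r hr.le]
    calc |tent z - tent w| * ‖v‖ ≤ ‖z - w‖ / r * ‖v‖ := by gcongr; exact hlip z w
      _ = ‖v‖ / r * ‖z - w‖ := by ring
  refine ⟨happ.toHomeomorph _ ?_, fun z => rfl⟩
  rcases subsingleton_or_nontrivial E with h | h
  · exact Or.inl h
  · refine Or.inr ?_
    have : ‖((ContinuousLinearEquiv.refl ℝ E).symm : E →L[ℝ] E)‖₊ = 1 :=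
      ContinuousLinearMap.nnnorm_id
    rw [this, inv_one, ← NNReal.coe_lt_coe, NNReal.coe_div, coe_nnnorm,
      Real.coe_toNNReal r hr.le]
    exact (div_lt_one hr).2 hv

section
variable {M : Type*} [TopologicalSpace M] [T2Space M] {E : Type*} [NormedAddCommGroup E]
  [NormedSpace ℝ E] [ProperSpace E] (e : OpenPartialHomeomorph M E)

theorem OpenPartialHomeomorph.pushableIn_closedBall {x y : E} {r : ℝ}
    (hr : Metric.closedBall x r ⊆ e.target) (hy : y ∈ Metric.ball x r) :
    PushableIn (e.symm '' Metric.closedBall x r) (e.symm x) (e.symm y) := by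
  have hr0 : 0 < r := dist_nonneg.trans_lt (Metric.mem_ball.1 hy)
  have hv (t : I) : ‖(t : ℝ) • (y - x)‖ < r := by
    rw [norm_smul, Real.norm_of_nonneg t.2.1, ← dist_eq_norm]
    exact (mul_le_of_le_one_left dist_nonneg t.2.2).trans_lt hy
  have hx : x ∈ e.target := hr (Metric.mem_closedBall_self hr0.le)
  choose f hf using fun t : I => exists_homeomorph_add_tent x ((t : ℝ) • (y - x)) (hv t)
  have hfx (t : I) : f t x = x + (t : ℝ) • (y - x) := by simp [hf]
  have hfr (t : I) : f t x ∈ Metric.closedBall x r := by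
    rw [hfx, mem_closedBall_iff_norm, add_sub_cancel_left]
    exact (hv t).le
  let ρ : Path (e.symm x) (e.symm y) :=
    { toFun := fun t => e.symm (f t x)
      continuous_toFun := by
        refine e.continuousOn_symm.comp_continuous ?_ fun t => hr (hfr t)
        simp only [hfx]
        fun_prop
      source' := by simp [hfx]
      target' := by simp [hfx] }
  refine ⟨ρ, e.isTrack_of_isotopy (f := f) ?_ ?_ (isCompact_closedBall x r) hr ?_ (e.map_target hx)
    fun t => ?_, ?_⟩
  · simp only [hf]
    fun_prop
  · ext z
    simp [hf]
  · intro t z hz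
    have : 1 - dist z x / r ≤ 0 := by
      rw [sub_nonpos, one_le_div hr0]
      exact (not_le.1 hz).le
    simp [hf, max_eq_left this]
  · rw [e.right_inv hx]
    rfl
  · rintro _ ⟨t, rfl⟩
    exact ⟨_, hfr t, rfl⟩

theorem OpenPartialHomeomorph.pushableIn_of_isPreconnected {C : Set E} (hC : IsOpen C)
    (hC' : IsPreconnected C) (hCe : C ⊆ e.target) {x y : E} (hx : x ∈ C) (hy : y ∈ C) :
    PushableIn (e.symm '' C) (e.symm x) (e.symm y) := by
  refine hC'.induction₂ (fun x y => PushableIn (e.symm '' C) (e.symm x) (e.symm y))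
    (fun x hx => ?_) (fun x y z _ _ _ h h' => h.trans h') (fun x y _ _ h => h.symm) hx hy
  obtain ⟨r, hr, hrC⟩ := Metric.nhds_basis_closedBall.mem_iff.1 (hC.mem_nhds hx)
  filter_upwards [mem_nhdsWithin_of_mem_nhds (Metric.ball_mem_nhds x hr)] with y hy
  exact (e.pushableIn_closedBall (hrC.trans hCe) hy).mono (image_mono hrC)

end

/-! ### Half-ball neighbourhoods -/

/-- Two paths that factor through a convex set with the same endpoints there are homotopic, by the
straight-line homotopy. -/
theorem Path.Homotopic.of_convex {M E : Type*} [TopologicalSpace M] [AddCommGroup E] [Module ℝ E]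
    [TopologicalSpace E] [IsTopologicalAddGroup E] [ContinuousSMul ℝ E] {ψ : E → M} {C : Set E}
    (hC : Convex ℝ C) (hψ : ContinuousOn ψ C) {a b : M} {α β : Path a b} {u w : I → E}
    (hu : Continuous u) (hw : Continuous w) (huC : ∀ t, u t ∈ C) (hwC : ∀ t, w t ∈ C)
    (hα : ∀ t, ψ (u t) = α t) (hβ : ∀ t, ψ (w t) = β t) (h0 : u 0 = w 0) (h1 : u 1 = w 1) :
    α.Homotopic β := by
  refine ⟨⟨⟨⟨fun q => ψ (AffineMap.lineMap (u q.2) (w q.2) (q.1 : ℝ)), ?_⟩, ?_, ?_⟩, ?_⟩⟩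
  · refine hψ.comp_continuous ?_ fun q => hC.lineMap_mem (huC _) (hwC _) q.1.2
    simp only [AffineMap.lineMap_apply_module]
    fun_prop
  · simp [hα]
  · simp [hβ]
  · rintro t s (rfl | rfl)
    · simp [h0, hβ]
    · simp [h1, hβ]

/-- A set in which any two interior points of `M` can be pushed to one another, and which is
relatively simply connected in `M`. -/
structure IsPushSet {M : Type*} [TopologicalSpace M] (N : Set M) : Prop where
  homotopic : ∀ {a b : M} {α β : Path a b}, range α ⊆ N → range β ⊆ N → α.Homotopic β
  pushableIn : ∀ {a b : M}, a ∈ N → a ∈ interior3 M → b ∈ N → b ∈ interior3 M → PushableIn N a b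

theorem IsPushSet.isTrackClass {M : Type*} [TopologicalSpace M] {N : Set M} (hN : IsPushSet N)
    {a b : M} (ha : a ∈ interior3 M) (hb : b ∈ interior3 M) {α : Path a b} (hα : range α ⊆ N) :
    IsTrackClass (Path.Homotopic.Quotient.mk α) := by
  obtain ⟨ρ, hρ, hρN⟩ := hN.pushableIn (hα ⟨0, α.source⟩) ha (hα ⟨1, α.target⟩) hb
  exact ⟨ρ, hρ, Path.Homotopic.Quotient.eq.2 (hN.homotopic hρN hα)⟩

open scoped Manifold

/-- The open half-space `{x₀ > 0}` as a chart of the closed half-space with values in `ℝ³`. -/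
noncomputable def halfSpaceInterior :
    OpenPartialHomeomorph (EuclideanHalfSpace 3) (EuclideanSpace ℝ (Fin 3)) where
  toFun := 𝓡∂ 3
  invFun := (𝓡∂ 3).symm
  source := {z | 0 < z.1 0}
  target := {z | 0 < z 0}
  map_source' _ hz := hz
  map_target' z hz := by
    have hz' : (𝓡∂ 3) ((𝓡∂ 3).symm z) = z :=
      (𝓡∂ 3).right_inv (by
      rw [range_modelWithCornersEuclideanHalfSpace]
      exact (show 0 < z 0 from hz).le)
    change 0 < ((𝓡∂ 3) ((𝓡∂ 3).symm z)) 0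
    rwa [hz']
  left_inv' z _ := (𝓡∂ 3).left_inv z
  right_inv' z hz :=
    (𝓡∂ 3).right_inv (by
      rw [range_modelWithCornersEuclideanHalfSpace]
      exact (show 0 < z 0 from hz).le)
  open_source := isOpen_lt continuous_const (by fun_prop)
  open_target := isOpen_lt continuous_const (by fun_prop)
  continuousOn_toFun := (𝓡∂ 3).continuous.continuousOn
  continuousOn_invFun := (𝓡∂ 3).continuous_symm.continuousOn

/-- Every point has arbitrarily small neighbourhoods that correspond to half-balls in a chart, and
these are push sets. An interior point of `M` in the half-ball is not assumed to lie off the flat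
face of the half-ball: it is first pushed off, in a chart with values in `ℝ³`, so that invariance of
domain is not needed. -/
theorem exists_isPushSet {M : Type*} [TopologicalSpace M] [T2Space M]
    [ChartedSpace (EuclideanHalfSpace 3) M] (x : M) {U : Set M} (hU : U ∈ 𝓝 x) :
    ∃ N ∈ 𝓝 x, N ⊆ U ∧ IsPushSet N ∧ ∃ q ∈ interior3 M, ∃ τ : Path x q, range τ ⊆ N := by
  set φ := extChartAt (𝓡∂ 3) x with hφ
  have hS : range (𝓡∂ 3) = {z | 0 ≤ z 0} := range_modelWithCornersEuclideanHalfSpace 3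
  obtain ⟨r, hr, hrU⟩ : ∃ r > 0, Metric.ball (φ x) r ∩ range (𝓡∂ 3) ⊆ φ.symm ⁻¹' U ∩ φ.target := by
    refine Metric.mem_nhdsWithin_iff.1 (inter_mem (mem_nhdsWithin_of_mem_nhds ?_)
      (extChartAt_target_mem_nhdsWithin x))
    exact (continuousAt_extChartAt_symm x).preimage_mem_nhds (by
      rwa [extChartAt_to_inv])
  set B := Metric.ball (φ x) r with hB
  set N := φ.source ∩ φ ⁻¹' B with hN
  set P : Set (EuclideanSpace ℝ (Fin 3)) := B ∩ {z | 0 < z 0} with hP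
  have hNo : IsOpen N := isOpen_extChartAt_preimage' x Metric.isOpen_ball
  have hxN : x ∈ N := ⟨mem_extChartAt_source x, Metric.mem_ball_self hr⟩
  have hNC {y : M} (hy : y ∈ N) : φ y ∈ B ∩ range (𝓡∂ 3) :=
    ⟨hy.2, extChartAt_target_subset_range x (φ.map_source hy.1)⟩
  have hCN {z} (hz : z ∈ B ∩ range (𝓡∂ 3)) : φ.symm z ∈ N := by
    refine ⟨φ.map_target (hrU hz).2, ?_⟩
    rw [mem_preimage, φ.right_inv (hrU hz).2]
    exact hz.1
  have hPC : P ⊆ B ∩ range (𝓡∂ 3) := inter_subset_inter_right _ fun z hz => by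
    rw [hS]
    exact (show 0 < z 0 from hz).le
  have hCc : Convex ℝ (B ∩ range (𝓡∂ 3)) :=
    (convex_ball _ _).inter (𝓡∂ 3).convex_range
  have hsymm : ContinuousOn φ.symm (B ∩ range (𝓡∂ 3)) :=
    (continuousOn_extChartAt_symm x).mono fun z hz => (hrU hz).2
  -- the open half-ball is dense in the half-ball
  have hdense {a : M} (ha : a ∈ N) {O : Set M} (hO : O ∈ 𝓝 a) : ∃ z ∈ P, φ.symm z ∈ O := by
    let l (s : ℝ) : EuclideanSpace ℝ (Fin 3) := φ a + s • EuclideanSpace.single 0 1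
    have hl : Tendsto l (𝓝[>] 0) (𝓝 (φ a)) := by
      have : ContinuousAt l 0 := by fun_prop
      simpa [l, ContinuousAt] using this.tendsto.mono_left nhdsWithin_le_nhds
    have h1 : ∀ᶠ s in 𝓝[>] (0 : ℝ), l s ∈ B := hl (Metric.isOpen_ball.mem_nhds ha.2)
    have h2 : ∀ᶠ s in 𝓝[>] (0 : ℝ), φ.symm (l s) ∈ O :=
      hl ((continuousAt_extChartAt_symm' ha.1).preimage_mem_nhds
        (by rwa [φ.left_inv ha.1]))
    obtain ⟨s, hs1, hs2, hs3⟩ := (h1.and (h2.and self_mem_nhdsWithin)).exists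
    refine ⟨l s, ⟨hs1, ?_⟩, hs2⟩
    have h0 : 0 ≤ φ a 0 := by
      have := (hNC ha).2
      rwa [hS] at this
    have hs : 0 < s := hs3
    simp only [l, mem_ofPred_eq, PiLp.add_apply, PiLp.smul_apply, PiLp.single_apply]
    simp
    positivity
  let e := (chartAt (EuclideanHalfSpace 3) x).trans halfSpaceInterior
  have hPe : P ⊆ e.target := by
    intro z hz
    have := (hrU (hPC hz)).2
    rw [hφ, extChartAt_target] at this
    exact ⟨hz.2, this.1⟩
  have hPint {z} (hz : z ∈ P) : φ.symm z ∈ interior3 M := ⟨e, e.map_target (hPe hz)⟩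
  have hPo : IsOpen P := Metric.isOpen_ball.inter (isOpen_lt continuous_const (by fun_prop))
  have hPconv : Convex ℝ P := (convex_ball _ _).inter
    (convex_halfSpace_gt (f := fun z : EuclideanSpace ℝ (Fin 3) => z 0)
      ⟨fun _ _ => rfl, fun _ _ => rfl⟩ 0)
  have hpushP {z z'} (hz : z ∈ P) (hz' : z' ∈ P) : PushableIn N (φ.symm z) (φ.symm z') :=
    (e.pushableIn_of_isPreconnected hPo hPconv.isPreconnected hPe hz hz').mono
      (image_subset_iff.2 fun z hz => hCN (hPC hz))
  have hpush {a : M} (ha : a ∈ N) (ha' : a ∈ interior3 M) :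
      ∃ z ∈ P, PushableIn N a (φ.symm z) := by
    obtain ⟨f, hf⟩ := ha'
    obtain ⟨δ, hδ, hδN⟩ := Metric.nhds_basis_closedBall.mem_iff.1
      (inter_mem (f.open_target.mem_nhds (f.map_source hf))
        ((f.continuousAt_symm (f.map_source hf)).preimage_mem_nhds
          (by rw [f.left_inv hf]; exact hNo.mem_nhds ha)))
    obtain ⟨z, hz, hzf, hzδ⟩ := hdense ha (inter_mem (f.open_source.mem_nhds hf)
      ((f.continuousAt hf).preimage_mem_nhds (Metric.ball_mem_nhds _ hδ)))
    refine ⟨z, hz, ?_⟩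
    have := f.pushableIn_closedBall (hδN.trans inter_subset_left) hzδ
    rw [f.left_inv hf, f.left_inv hzf] at this
    exact this.mono (image_subset_iff.2 (hδN.trans inter_subset_right))
  refine ⟨N, hNo.mem_nhds hxN, fun y hy => ?_, ⟨fun {a b α β} hα hβ => ?_, fun ha ha' hb hb' => ?_⟩,
    ?_⟩
  · simpa [φ.left_inv hy.1] using (hrU (hNC hy)).1
  · have hc {γ : Path a b} (hγ : range γ ⊆ N) : Continuous fun t => φ (γ t) :=
      (continuousOn_extChartAt x).comp_continuous γ.continuous fun t => (hγ ⟨t, rfl⟩).1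
    exact Path.Homotopic.of_convex hCc hsymm (hc hα) (hc hβ) (fun t => hNC (hα ⟨t, rfl⟩))
      (fun t => hNC (hβ ⟨t, rfl⟩)) (fun t => φ.left_inv (hα ⟨t, rfl⟩).1)
      (fun t => φ.left_inv (hβ ⟨t, rfl⟩).1) (by simp) (by simp)
  · obtain ⟨z, hz, haz⟩ := hpush ha ha'
    obtain ⟨z', hz', hbz'⟩ := hpush hb hb'
    exact (haz.trans (hpushP hz hz')).trans hbz'.symm
  · obtain ⟨z, hz, -⟩ := hdense hxN univ_mem
    refine ⟨_, hPint hz, ?_⟩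
    have hj := ((hCc.isPathConnected ⟨_, hNC hxN⟩).image' hsymm).joinedIn _ ⟨_, hNC hxN, rfl⟩ _
      ⟨z, hPC hz, rfl⟩
    rw [φ.left_inv hxN.1] at hj
    refine ⟨hj.somePath, range_subset_iff.2 fun t => ?_⟩
    obtain ⟨w, hw, hwt⟩ := hj.somePath_mem t
    exact hwt ▸ hCN hw

/-! ### Existence of push maps -/

theorem IsTrackClass.of_cast {M : Type*} [TopologicalSpace M] {a b a' b' : M} {γ : Path a b}
    {h : a' = a} {h' : b' = b} (hγ : IsTrackClass (Path.Homotopic.Quotient.mk (γ.cast h h'))) :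
    IsTrackClass (Path.Homotopic.Quotient.mk γ) := by
  subst h h'
  exact hγ

section
variable {M : Type*} [TopologicalSpace M] [T2Space M] [ChartedSpace (EuclideanHalfSpace 3) M]

/-- Every path class between interior points contains the track of an ambient isotopy. As the path
itself may meet the boundary, the statement that is propagated along `γ` is that, for every
neighbourhood `U` of `γ t`, the part of `γ` up to time `t` can be continued inside `U` to a path in
a track class that ends at an interior point. -/
theorem isTrackClass_of_mem_interior3 {a b : M} (γ : Path a b) (ha : a ∈ interior3 M)
    (hb : b ∈ interior3 M) : IsTrackClass (Path.Homotopic.Quotient.mk γ) := by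
  rw [← γ.source] at ha
  rw [← γ.target] at hb
  let Q (t : I) : Prop := ∀ U ∈ 𝓝 (γ t), ∃ q ∈ interior3 M, ∃ τ : Path (γ t) q, range τ ⊆ U ∧
    IsTrackClass (Path.Homotopic.Quotient.mk ((γ.subpath 0 t).trans τ))
  have hstep {s t : I} {N : Set M} (hN : IsPushSet N) (hst : uIcc s t ⊆ γ ⁻¹' N)
      (hNs : N ∈ 𝓝 (γ s)) (hNt : N ∈ 𝓝 (γ t)) (hs : Q s) : Q t := by
    intro U hU
    obtain ⟨q, hq, τ, hτN, hτ⟩ := hs N hNs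
    obtain ⟨N', -, hN'U, -, q', hq', τ', hτ'⟩ := exists_isPushSet (γ t) (inter_mem hU hNt)
    refine ⟨q', hq', τ', (hτ'.trans hN'U).trans inter_subset_left, ?_⟩
    have hsub : range (γ.subpath s t) ⊆ N := by
      rw [Path.range_subpath]
      exact image_subset_iff.2 hst
    have h2 := hτ.trans (hN.isTrackClass hq hq' (α := τ.symm.trans ((γ.subpath s t).trans τ')) (by
      rw [Path.trans_range, Path.trans_range, Path.symm_range]
      exact union_subset hτN (union_subset hsub ((hτ'.trans hN'U).trans inter_subset_right))))
    have h3 : Path.Homotopic.Quotient.mk (γ.subpath 0 t) =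
        (Path.Homotopic.Quotient.mk (γ.subpath 0 s)).trans
          (Path.Homotopic.Quotient.mk (γ.subpath s t)) := by
      rw [← Path.Homotopic.Quotient.mk_trans]
      exact Path.Homotopic.Quotient.eq.2 ⟨(Path.Homotopy.subpathTransSubpath γ 0 s t).symm⟩
    rw [Path.Homotopic.Quotient.mk_trans, h3]
    simp only [Path.Homotopic.Quotient.mk_trans, Path.Homotopic.Quotient.mk_symm] at h2
    convert h2 using 1
    rw [Path.Homotopic.Quotient.trans_assoc, Path.Homotopic.Quotient.trans_assoc,
      ← Path.Homotopic.Quotient.trans_assoc _ (Path.Homotopic.Quotient.symm _),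
      Path.Homotopic.Quotient.trans_symm, Path.Homotopic.Quotient.refl_trans]
  have hQ0 : Q 0 := by
    intro U hU
    refine ⟨γ 0, ha, Path.refl _, by simpa using mem_of_mem_nhds hU, ?_⟩
    refine ⟨Path.refl _, ⟨1, ⟨fun _ => 1, continuous_fst, rfl, rfl⟩, fun _ => rfl⟩, ?_⟩
    rw [Path.subpath_self]
    exact Path.Homotopic.Quotient.eq.2 (Path.Homotopic.refl_trans _).symm
  have hQ1 : Q 1 := by
    refine PreconnectedSpace.induction₂' (fun s t => Q s → Q t) (fun s => ?_)
      ⟨fun _ _ _ h h' hs => h' (h hs)⟩ 0 1 hQ0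
    obtain ⟨N, hNs, -, hN, -⟩ := exists_isPushSet (γ s) univ_mem
    have h1 : γ ⁻¹' N ∈ 𝓝 s := γ.continuous.continuousAt.preimage_mem_nhds hNs
    have h2 : ∀ᶠ t in 𝓝 s, uIcc s t ⊆ γ ⁻¹' N :=
      (tendsto_const_nhds.uIcc tendsto_id).eventually (eventually_smallSets_subset.2 h1)
    have h3 : ∀ᶠ t in 𝓝 s, N ∈ 𝓝 (γ t) :=
      γ.continuous.continuousAt.eventually (eventually_mem_nhds_iff.2 hNs)
    filter_upwards [h2, h3] with t ht ht'
    exact ⟨hstep hN ht hNs ht', hstep hN (uIcc_comm s t ▸ ht) ht' hNs⟩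
  obtain ⟨N, hNx, -, hN, -⟩ := exists_isPushSet (γ 1) univ_mem
  obtain ⟨q, hq, τ, hτN, hτ⟩ := hQ1 N hNx
  have h2 := hτ.trans (hN.isTrackClass hq hb (α := τ.symm) (by rwa [Path.symm_range]))
  rw [Path.Homotopic.Quotient.mk_trans, Path.Homotopic.Quotient.mk_symm,
    Path.Homotopic.Quotient.trans_assoc, Path.Homotopic.Quotient.trans_symm,
    Path.Homotopic.Quotient.trans_refl, Path.subpath_zero_one] at h2
  exact h2.of_cast

/-- Every element of `π₁(M, p)` has a push map, so that `pointPushingMap` never takes its default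
value. -/
theorem exists_isPushClass {p : M} (hp : p ∈ interior3 M) (g : FundamentalGroup M p) :
    ∃ c, IsPushClass g c := by
  obtain ⟨γ, rfl⟩ := Path.Homotopic.Quotient.mk_surjective g
  obtain ⟨ρ, ⟨φ, H, hH⟩, hρ⟩ := isTrackClass_of_mem_interior3 γ hp hp
  have hφ : φ p = p := by rw [← H.level_one, hH, ρ.target]
  exact ⟨_, ρ, φ, hφ, fun t => hH t ▸ (Homeomorph.apply_mem_interior3_iff _ _).2 hp, hρ,
    ⟨H, hH⟩, rfl⟩

end

theorem mainTheorem4 (M : Type*) [TopologicalSpace M] [T2Space M] [CompactSpace M]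
    [ConnectedSpace M] [ChartedSpace (EuclideanHalfSpace 3) M]
    (p : M) (hp : p ∈ interior3 M) :
    {g : FundamentalGroup M p | pointPushingMap M p g = 1} ⊆
      (Subgroup.center (FundamentalGroup M p) : Set (FundamentalGroup M p)) := by
  intro g hg
  have : LocallyConnectedSpace M := ChartedSpace.locallyConnectedSpace (EuclideanHalfSpace 3) M
  have h := exists_isPushClass hp g
  obtain ⟨ρ, φ, hφ, -, rfl, hρ, hc⟩ := h.choose_spec
  rw [mem_ofPred_eq, pointPushingMap, dif_pos h, hc, QuotientGroup.eq_one_iff] at hg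
  exact mem_center_of_puncture_mem_homeoZero hφ hρ hg
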